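/- Let $r$ and $n$ be integers with $1\le r<n$, and let $K_{2n}$ be the complete graph with vertex set $V$, $|V|=2n$, and edge set $E=\binom{V}{2}$. An \emph{$r$-matching} is a set of $r$ pairwise disjoint edges of $K_{2n}$; let $\mathcal{M}^r_n$ be the family of all $r$-matchings, and for $e\in E$ let $\mathcal{M}^r_n(e)=\{A\in\mathcal{M}^r_n : e\in A\}$ be the star centered at $e$. Put $$\phi(n,r)=\frac{1}{(r-1)!}\prod_{i=1}^{r-1}\binom{2n-2i}{2}.$$ If $\mathcal{A}\subseteq\mathcal{M}^r_n$ is an intersecting family, i.e. any two members of $\mathcal{A}$ share at least one edge, then $|\mathcal{A}|\le\phi(n,r)$, and equality holds if and only if $\mathcal{A}=\mathcal{M}^r_n(e)$ for some $e\in E$. (In particular, $\phi(n,r)$ is the number of $r$-matchings containing any given edge.) -/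

import Mathlib

/-- The family of all `r`-matchings of the complete graph on the vertex set `Fin (2 * n)`:
the sets of `r` edges that pairwise have no common vertex. -/
def rMatchings (n r : ℕ) : Finset (Finset (Sym2 (Fin (2 * n)))) :=
  {M ∈ (⊤ : SimpleGraph (Fin (2 * n))).edgeFinset.powersetCard r |
    ∀ e ∈ M, ∀ f ∈ M, e ≠ f → ∀ v, v ∈ e → v ∉ f}

/-- The star centered at the edge `e`: all `r`-matchings that contain `e`. -/
def matchingStar (n r : ℕ) (e : Sym2 (Fin (2 * n))) : Finset (Finset (Sym2 (Fin (2 * n)))) :=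
  {M ∈ rMatchings n r | e ∈ M}

/-- The number
`φ(n, r) = C(2n-2, 2) * C(2n-4, 2) * ... * C(2n-2(r-1), 2) / (r-1)!`, for `1 ≤ r ≤ n`. -/
def matchingPhi (n r : ℕ) : ℚ :=
  (∏ i ∈ Finset.Icc 1 (r - 1), ((2 * n - 2 * i).choose 2 : ℚ)) / ((r - 1).factorial : ℚ)

/-! Katona's cycle method. The `n * (2 * n - 1)` edges of the complete graph are arranged on a cycle
so that any `n - 1` consecutive ones form a matching (`exists_cyclic_ordering`). As `r < n`, all
windows of length `r` are `r`-matchings, also after any relabelling of the vertices. In each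
relabelled cycle at most `r` windows pairwise overlap (`card_le_of_windowsMeet`), and by
transitivity of vertex permutations on `r`-matchings (`exists_permEdges_eq`) each `r`-matching is
equally often the window at a given position. Averaging gives N|𝒜| ≤ r·(number of `r`-matchings),
with N the number of edges; double counting evaluates the right side as N·φ(n, r).

If equality holds, every relabelling has exactly `r` windows in 𝒜, necessarily those through one
position, its center (`exists_center_of_windowsMeet`). Let p be the center for the identity. A
window in 𝒜 next to one outside 𝒜 locates the center, so vertex permutations stabilizing two such
windows keep it at p; they generate enough to include all swaps of vertices of the `r - 1` edges P
following p. For `r ≥ 3`, if some B in 𝒜 missed the edge `c p`, these swaps would move P off B while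
fixing `c p`, producing a member of 𝒜 disjoint from B (`IsMatchingCycle.center_mem`). So 𝒜 lies in a
star, and the sizes agree. For `r = 2` the set P is a single edge and the argument fails; there the
only obstruction is a triangle of pairs, which is too small. -/

open Equiv

/-! ### Overlapping windows on a cycle. -/

/-- Two positions on a cycle of length `N` start overlapping windows of length `r`. -/
def WindowsMeet (N r : ℕ) (x y : ZMod N) : Prop :=
  ∃ a < r, ∃ b < r, x + (a : ZMod N) = y + (b : ZMod N)

theorem natCast_zmod_inj {N a b : ℕ} (ha : a < N) (hb : b < N)
    (h : (a : ZMod N) = (b : ZMod N)) : a = b := by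
  rw [ZMod.natCast_eq_natCast_iff'] at h
  rwa [Nat.mod_eq_of_lt ha, Nat.mod_eq_of_lt hb] at h

/-- Windows whose starting points differ by `d` do not overlap if `r ≤ d` and `d + r ≤ N`. -/
theorem not_windowsMeet_of_add {N r d : ℕ} {x y : ZMod N} (hd : r ≤ d) (hN : d + r ≤ N)
    (h : y = x + (d : ZMod N)) : ¬ WindowsMeet N r x y := by
  rintro ⟨a, ha, b, hb, hab⟩
  rw [h, add_assoc, add_right_inj, ← Nat.cast_add] at hab
  have := natCast_zmod_inj (by omega) (by omega) hab
  omega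

/-- The starts of windows meeting the one at `x₀` are grouped into `r` pairs whose members are `r`
apart. The pair `i = 0` contains `x₀` itself. -/
theorem subset_of_windowsMeet {N r : ℕ} (S : Finset (ZMod N)) {x₀ : ZMod N} (hx₀ : x₀ ∈ S)
    (hS : ∀ x ∈ S, ∀ y ∈ S, WindowsMeet N r x y) {y : ZMod N} (hy : y ∈ S) :
    ∃ i < r, y = x₀ + (i : ZMod N) ∨ y = x₀ + (i : ZMod N) - (r : ZMod N) := by
  obtain ⟨a, ha, b, hb, hab⟩ := hS x₀ hx₀ y hy
  rcases le_or_gt b a with h | h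
  · refine ⟨a - b, by omega, Or.inl ?_⟩
    rw [Nat.cast_sub h]
    linear_combination -hab
  · refine ⟨a + r - b, by omega, Or.inr ?_⟩
    rw [Nat.cast_sub (by omega), Nat.cast_add]
    linear_combination -hab

/-- The two windows of a pair are disjoint because `2 * r ≤ N`, so each index in `I` accounts for at
most one element of `S`. A general `I` allows one pair to be dropped in the equality case. -/
theorem card_le_of_cover {N r : ℕ} (hN : 2 * r ≤ N) (S : Finset (ZMod N)) (x₀ : ZMod N)
    (hS : ∀ x ∈ S, ∀ y ∈ S, WindowsMeet N r x y) (I : Finset ℕ)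
    (hI : ∀ y ∈ S, ∃ i ∈ I, y = x₀ + (i : ZMod N) ∨ y = x₀ + (i : ZMod N) - (r : ZMod N)) :
    S.card ≤ I.card := by
  classical
  have hsub : S ⊆ I.biUnion fun i =>
      {y ∈ S | y = x₀ + (i : ZMod N) ∨ y = x₀ + (i : ZMod N) - (r : ZMod N)} := by
    intro y hy
    obtain ⟨i, hi, h⟩ := hI y hy
    exact Finset.mem_biUnion.2 ⟨i, hi, Finset.mem_filter.2 ⟨hy, h⟩⟩
  refine (Finset.card_le_card hsub).trans ((Finset.card_biUnion_le_card_mul _ _ 1 ?_).trans_eq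
    (mul_one _))
  intro i _
  refine Finset.card_le_one.2 ?_
  simp only [Finset.mem_filter]
  rintro y ⟨hy, rfl | rfl⟩ z ⟨hz, rfl | rfl⟩
  · rfl
  · exact absurd (hS _ hz _ hy) (not_windowsMeet_of_add le_rfl (by omega) (by ring))
  · exact absurd (hS _ hy _ hz) (not_windowsMeet_of_add le_rfl (by omega) (by ring))
  · rfl

/-- On a cycle of length `N ≥ 2r` there are at most `r` pairwise overlapping `r`-windows. -/
theorem card_le_of_windowsMeet {N r : ℕ} (hN : 2 * r ≤ N) (S : Finset (ZMod N))
    (hS : ∀ x ∈ S, ∀ y ∈ S, WindowsMeet N r x y) : S.card ≤ r := by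
  rcases S.eq_empty_or_nonempty with rfl | ⟨x₀, hx₀⟩
  · simp
  · simpa using card_le_of_cover hN S x₀ hS (Finset.range r) fun y hy => by
      simpa using subset_of_windowsMeet S hx₀ hS hy

/-- If `r` windows of length `r` on a cycle of length `N > 2r` pairwise overlap, they are exactly
the windows through some position `p`. -/
theorem exists_center_of_windowsMeet {N r : ℕ} (hr : 1 ≤ r) (hN : 2 * r < N) (S : Finset (ZMod N))
    (hS : ∀ x ∈ S, ∀ y ∈ S, WindowsMeet N r x y) (hcard : S.card = r) :
    ∃ p : ZMod N, ∀ y, y ∈ S ↔ ∃ a < r, y + (a : ZMod N) = p := by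
  classical
  obtain ⟨x₀, hx₀⟩ : S.Nonempty := Finset.card_pos.1 (by omega)
  -- No pair can be missed, since otherwise `r - 1` pairs would cover `S`.
  have hor : ∀ i < r, x₀ + (i : ZMod N) ∈ S ∨ x₀ + (i : ZMod N) - (r : ZMod N) ∈ S := by
    intro i hi
    by_contra! hcon
    have := card_le_of_cover hN.le S x₀ hS ((Finset.range r).erase i) fun y hy => by
      obtain ⟨j, hj, h⟩ := subset_of_windowsMeet S hx₀ hS hy
      refine ⟨j, ?_, h⟩
      rw [Finset.mem_erase, Finset.mem_range]
      refine ⟨?_, hj⟩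
      rintro rfl
      rcases h with rfl | rfl
      · exact hcon.1 hy
      · exact hcon.2 hy
    rw [Finset.card_erase_of_mem (Finset.mem_range.2 hi), Finset.card_range] at this
    omega
  -- Otherwise `S` contains two starts at distance `r + 1`, whose windows are disjoint. This is
  -- where `2 * r < N` must be strict.
  have hdown : ∀ i, i + 1 < r → x₀ + ((i + 1 : ℕ) : ZMod N) ∈ S → x₀ + (i : ZMod N) ∈ S := by
    intro i hi h
    refine (hor i (by omega)).resolve_right fun h' => ?_
    exact not_windowsMeet_of_add (d := r + 1) (by omega) (by omega) (by push_cast; ring)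
      (hS _ h' _ h)
  -- The pairs switch from their first to their second member after index `k`, so `S` is the run of
  -- `r` consecutive positions ending at `x₀ + k`.
  set k := Nat.findGreatest (fun i => x₀ + (i : ZMod N) ∈ S) (r - 1) with hk
  have hkr : k ≤ r - 1 := Nat.findGreatest_le _
  have hkS : x₀ + (k : ZMod N) ∈ S :=
    Nat.findGreatest_spec (P := fun i => x₀ + (i : ZMod N) ∈ S) (Nat.zero_le _) (by simpa using hx₀)
  have hle : ∀ d ≤ k, x₀ + ((k - d : ℕ) : ZMod N) ∈ S := by
    intro d
    induction d with
    | zero => intro _; simpa using hkS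
    | succ d ih =>
      intro hd
      have := ih (by omega)
      refine hdown _ (by omega) ?_
      rwa [show k - (d + 1) + 1 = k - d by omega]
  have hsub : (Finset.range r).image (fun a : ℕ => x₀ + (k : ZMod N) - (a : ZMod N)) ⊆ S := by
    intro y hy
    obtain ⟨a, ha, rfl⟩ := Finset.mem_image.1 hy
    rw [Finset.mem_range] at ha
    rcases le_or_gt a k with h | h
    · have := hle a h
      rwa [Nat.cast_sub h, ← add_sub_assoc] at this
    · have h1 := (hor (r + k - a) (by omega)).resolve_left
        (Nat.findGreatest_is_greatest (P := fun i => x₀ + (i : ZMod N) ∈ S) (n := r - 1)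
          (by omega) (by omega))
      rw [Nat.cast_sub (by omega), Nat.cast_add] at h1
      convert h1 using 1
      ring
  have heq := Finset.eq_of_subset_of_card_le hsub (by
    rw [Finset.card_image_of_injOn, Finset.card_range, hcard]
    intro a ha b hb hab
    simp only [Finset.coe_range, Set.mem_Iio] at ha hb
    exact natCast_zmod_inj (by omega) (by omega) (sub_right_injective hab))
  refine ⟨x₀ + (k : ZMod N), fun y => ?_⟩
  rw [← heq]
  simp only [Finset.mem_image, Finset.mem_range]
  exact exists_congr fun a => and_congr_right fun _ => by
    rw [sub_eq_iff_eq_add, eq_comm]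

/-! ### The round-robin ordering of the edges. -/

/-- The two endpoints of the edge in position `q` of the round-robin ordering of the edges of the
complete graph on `ZMod (2 * n - 1)` with an additional vertex `none`. -/
def roundRobin (n q : ℕ) : Option (ZMod (2 * n - 1)) × Option (ZMod (2 * n - 1)) :=
  (if q % n = 0 then none else some ((q / n : ℕ) + (q % n : ℕ)), some ((q / n : ℕ) - (q % n : ℕ)))

/-- The block number `q / n` matters only modulo `2 * n - 1`, so the ordering closes up into a
cycle. -/
theorem roundRobin_mod (n q : ℕ) :
    roundRobin n (q % (n * (2 * n - 1))) = roundRobin n q := by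
  have h1 : q % (n * (2 * n - 1)) % n = q % n := Nat.mod_mul_right_mod q n _
  have h2 : ((q % (n * (2 * n - 1)) / n : ℕ) : ZMod (2 * n - 1)) =
      ((q / n : ℕ) : ZMod (2 * n - 1)) := by
    rw [Nat.mod_mul_right_div_self, ZMod.natCast_mod]
  simp only [roundRobin, h1, h2]

/-- With `q = t + n * j`, the edge joins `j + t` and `j - t`, or `none` and `j` if `t = 0`. A common
vertex becomes a congruence modulo `2 * n - 1` between numbers too small and too close to satisfy
it. -/
theorem roundRobin_disjoint {n : ℕ} (hn : 2 ≤ n) (q k : ℕ) (hk : 0 < k) (hkn : k + 1 < n) :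
    (roundRobin n q).1 ≠ (roundRobin n (q + k)).1 ∧ (roundRobin n q).1 ≠ (roundRobin n (q + k)).2 ∧
    (roundRobin n q).2 ≠ (roundRobin n (q + k)).1 ∧
    (roundRobin n q).2 ≠ (roundRobin n (q + k)).2 := by
  have ht : q % n < n := Nat.mod_lt _ (by omega)
  have key : ∀ a b : ℕ, a < 2 * n - 1 → b < 2 * n - 1 → a ≠ b →
      (a : ZMod (2 * n - 1)) ≠ (b : ZMod (2 * n - 1)) := fun a b ha hb hab h =>
    hab (natCast_zmod_inj ha hb h)
  obtain ⟨j, hj⟩ : ∃ j, j = q / n := ⟨_, rfl⟩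
  obtain ⟨t, htt⟩ : ∃ t, t = q % n := ⟨_, rfl⟩
  have hq : q = t + n * j := by rw [hj, htt, Nat.mod_add_div]
  rw [← htt] at ht
  rcases lt_or_ge (t + k) n with h | h
  · have h1 : (q + k) % n = t + k := by
      rw [hq, show t + n * j + k = t + k + n * j by ring, Nat.add_mul_mod_self_left,
        Nat.mod_eq_of_lt h]
    have h2 : (q + k) / n = j := by
      rw [hq, show t + n * j + k = t + k + n * j by ring, Nat.add_mul_div_left _ _ (by omega),
        Nat.div_eq_of_lt h, zero_add]
    have e1 := key t (t + k) (by omega) (by omega) (by omega)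
    have e2 := key (t + (t + k)) 0 (by omega) (by omega) (by omega)
    simp only [roundRobin, h1, h2, ← hj, ← htt]
    rw [if_neg (show ¬ t + k = 0 by omega)]
    push_cast at e1 e2 ⊢
    refine ⟨?_, ?_, ?_, ?_⟩ <;> (try split_ifs) <;> simp only [ne_eq, Option.some_inj, reduceCtorEq,
      not_false_eq_true] <;> intro hh
    · exact e1 (by linear_combination hh)
    · exact e2 (by linear_combination hh)
    · exact e2 (by linear_combination -hh)
    · exact e1 (by linear_combination -hh)
  -- The later edge lies in the next block. Since `k ≤ n - 2`, its offset satisfies `u ≤ t - 2`; for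
  -- `k = n - 1` one would have `u + 1 = t` and a common endpoint `j + t`.
  · obtain ⟨u, hu⟩ : ∃ u, t + k = u + n := ⟨t + k - n, by omega⟩
    have h1 : (q + k) % n = u := by
      rw [hq, show t + n * j + k = u + n * (j + 1) by linear_combination hu,
        Nat.add_mul_mod_self_left, Nat.mod_eq_of_lt (by omega)]
    have h2 : (q + k) / n = j + 1 := by
      rw [hq, show t + n * j + k = u + n * (j + 1) by linear_combination hu,
        Nat.add_mul_div_left _ _ (by omega), Nat.div_eq_of_lt (by omega), zero_add]
    have e1 := key t (1 + u) (by omega) (by omega) (by omega)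
    have e2 := key (t + u) 1 (by omega) (by omega) (by omega)
    have e3 := key (t + u + 1) 0 (by omega) (by omega) (by omega)
    have e4 := key u (t + 1) (by omega) (by omega) (by omega)
    simp only [roundRobin, h1, h2, ← hj, ← htt]
    rw [if_neg (show ¬ t = 0 by omega)]
    push_cast at e1 e2 e3 e4 ⊢
    refine ⟨?_, ?_, ?_, ?_⟩ <;> (try split_ifs) <;> simp only [ne_eq, Option.some_inj, reduceCtorEq,
      not_false_eq_true] <;> intro hh
    · exact e1 (by linear_combination hh)
    · exact e2 (by linear_combination hh)
    · exact e3 (by linear_combination -hh)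
    · exact e4 (by linear_combination hh)

theorem roundRobin_ne {n : ℕ} (hn : 2 ≤ n) (q : ℕ) :
    (roundRobin n q).1 ≠ (roundRobin n q).2 := by
  have ht : q % n < n := Nat.mod_lt _ (by omega)
  simp only [roundRobin]
  split_ifs with h
  · simp
  · simp only [ne_eq, Option.some_inj]
    intro hh
    have : ((q % n + q % n : ℕ) : ZMod (2 * n - 1)) = (0 : ℕ) := by
      push_cast; linear_combination hh
    have := natCast_zmod_inj (by omega) (by omega) this
    omega

/-- The endpoints of a finite edge sum to `2 * j`, and 2 is invertible modulo the odd number `2 * n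
- 1`, so the edge determines `j`, and then `t` up to sign. The bound `t < n` fixes the sign. -/
theorem roundRobin_injOn {n : ℕ} (hn : 2 ≤ n) {q q' : ℕ} (hq : q < n * (2 * n - 1))
    (hq' : q' < n * (2 * n - 1))
    (h : s((roundRobin n q).1, (roundRobin n q).2) = s((roundRobin n q').1, (roundRobin n q').2)) :
    q = q' := by
  have ht : q % n < n := Nat.mod_lt _ (by omega)
  have ht' : q' % n < n := Nat.mod_lt _ (by omega)
  have hj : q / n < 2 * n - 1 := Nat.div_lt_of_lt_mul hq
  have hj' : q' / n < 2 * n - 1 := Nat.div_lt_of_lt_mul hq'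
  have two : IsUnit (2 : ZMod (2 * n - 1)) := by
    refine (ZMod.isUnit_iff_coprime 2 (2 * n - 1)).2 ?_
    rw [Nat.coprime_two_left, Nat.odd_iff]; omega
  rw [← Nat.mod_add_div q n, ← Nat.mod_add_div q' n]
  have aux : ((q / n : ℕ) : ZMod (2 * n - 1)) = ((q' / n : ℕ) : ZMod (2 * n - 1)) → q % n = q' % n →
      q % n + n * (q / n) = q' % n + n * (q' / n) := by
    intro h1 h2
    rw [natCast_zmod_inj hj hj' h1, h2]
  simp only [roundRobin, Sym2.eq_iff] at h
  by_cases h0 : q % n = 0 <;> by_cases h0' : q' % n = 0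
  · simp only [h0, h0', if_true, Option.some_inj, true_and, reduceCtorEq, false_and, or_false] at h
    exact aux (by linear_combination h) (h0.trans h0'.symm)
  · simp [h0, h0'] at h
  · simp [h0, h0'] at h
  · simp only [h0, h0', if_false, Option.some_inj] at h
    have hjj : ((q / n : ℕ) : ZMod (2 * n - 1)) = ((q' / n : ℕ) : ZMod (2 * n - 1)) := by
      refine two.mul_left_cancel ?_
      rcases h with ⟨h1, h2⟩ | ⟨h1, h2⟩ <;> linear_combination h1 + h2
    refine aux hjj ?_
    rcases h with ⟨h1, h2⟩ | ⟨h1, h2⟩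
    · have : ((q % n : ℕ) : ZMod (2 * n - 1)) = ((q' % n : ℕ) : ZMod (2 * n - 1)) := by
        linear_combination h1 - hjj
      exact natCast_zmod_inj (by omega) (by omega) this
    · have : ((q % n + q' % n : ℕ) : ZMod (2 * n - 1)) = (0 : ℕ) := by
        push_cast; linear_combination h1 - hjj
      have := natCast_zmod_inj (by omega) (by omega) this
      omega

/-- The edges of the complete graph on `2n` vertices have a cyclic ordering in which any `n - 1`
consecutive edges form a matching. -/
theorem exists_cyclic_ordering {n : ℕ} (hn : 2 ≤ n) :
    ∃ c : ZMod (n * (2 * n - 1)) → Sym2 (Fin (2 * n)), Function.Injective c ∧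
      (∀ i, ¬ (c i).IsDiag) ∧
      ∀ i, ∀ k : ℕ, 0 < k → k + 1 < n → ∀ v ∈ c i, v ∉ c (i + (k : ZMod (n * (2 * n - 1)))) := by
  have : NeZero (2 * n - 1) := ⟨by omega⟩
  have : NeZero (n * (2 * n - 1)) := ⟨Nat.mul_ne_zero (by omega) (by omega)⟩
  have hcard : Fintype.card (Option (ZMod (2 * n - 1))) = Fintype.card (Fin (2 * n)) := by
    rw [Fintype.card_option, ZMod.card, Fintype.card_fin]; omega
  let φ := Fintype.equivOfCardEq hcard
  refine ⟨fun i => s(φ (roundRobin n i.val).1, φ (roundRobin n i.val).2), ?_, ?_, ?_⟩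
  · intro i j hij
    refine ZMod.val_injective _ (roundRobin_injOn hn (ZMod.val_lt i) (ZMod.val_lt j) ?_)
    refine Sym2.map.injective φ.injective ?_
    simpa only [Sym2.map_mk] using hij
  · intro i
    rw [Sym2.mk_isDiag_iff, φ.injective.eq_iff]
    exact roundRobin_ne hn _
  · intro i k hk hkn v hv hv'
    have hval : roundRobin n (i + (k : ZMod (n * (2 * n - 1)))).val = roundRobin n (i.val + k) := by
      rw [← roundRobin_mod n (i.val + k), ← ZMod.val_natCast, Nat.cast_add, ZMod.natCast_zmod_val]
    obtain ⟨h1, h2, h3, h4⟩ := roundRobin_disjoint hn i.val k hk hkn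
    simp only [hval, Sym2.mem_iff] at hv hv'
    rcases hv with rfl | rfl <;> rcases hv' with h | h <;> have := φ.injective h <;> contradiction

/-! ### Matchings under vertex permutations. -/

section Matchings

variable {V : Type*}

/-- A set of edges no two of which have a common vertex. -/
def IsEdgeMatching (M : Finset (Sym2 V)) : Prop :=
  (∀ e ∈ M, ¬ e.IsDiag) ∧ ∀ e ∈ M, ∀ f ∈ M, e ≠ f → ∀ v, v ∈ e → v ∉ f

theorem sym2_map_mul (g h : Perm V) (e : Sym2 V) :
    Sym2.map (⇑(g * h)) e = Sym2.map g (Sym2.map h e) := by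
  rw [Sym2.map_map, Perm.coe_mul]

theorem map_mem_sym2_map {g : Perm V} {v : V} {e : Sym2 V} : g v ∈ Sym2.map g e ↔ v ∈ e := by
  rw [Sym2.mem_map]
  exact ⟨fun ⟨w, hw, h⟩ => g.injective h ▸ hw, fun h => ⟨v, h, rfl⟩⟩

theorem isDiag_sym2_map {g : Perm V} {e : Sym2 V} : (Sym2.map g e).IsDiag ↔ e.IsDiag := by
  induction e with
  | _ a b => simp

theorem IsEdgeMatching.subset {M M' : Finset (Sym2 V)} (hM : IsEdgeMatching M) (h : M' ⊆ M) :
    IsEdgeMatching M' :=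
  ⟨fun e he => hM.1 e (h he), fun e he f hf => hM.2 e (h he) f (h hf)⟩

theorem IsEdgeMatching.eq_of_mem {M : Finset (Sym2 V)} (hM : IsEdgeMatching M) {e f : Sym2 V}
    {v : V} (he : e ∈ M) (hf : f ∈ M) (hv : v ∈ e) (hv' : v ∈ f) : e = f := by
  by_contra h
  exact hM.2 e he f hf h v hv hv'

theorem IsEdgeMatching.ne_of_mem {M : Finset (Sym2 V)} (hM : IsEdgeMatching M) {e f : Sym2 V}
    (he : e ∈ M) (hf : f ∈ M) (hef : e ≠ f) {v w : V} (hv : v ∈ e) (hw : w ∈ f) : v ≠ w := by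
  rintro rfl
  exact hM.2 e he f hf hef v hv hw

theorem sym2_map_eq_self {g : V → V} {e : Sym2 V} (h : ∀ v ∈ e, g v = v) : Sym2.map g e = e := by
  rw [Sym2.map_congr h, Sym2.map_id', id]

variable [DecidableEq V]

/-- The image of a set of edges under a permutation of the vertices. -/
def permEdges (g : Perm V) (M : Finset (Sym2 V)) : Finset (Sym2 V) := M.image (Sym2.map g)

theorem mem_permEdges {g : Perm V} {M : Finset (Sym2 V)} {e : Sym2 V} :
    e ∈ permEdges g M ↔ ∃ f ∈ M, Sym2.map g f = e := Finset.mem_image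

theorem map_mem_permEdges {g : Perm V} {M : Finset (Sym2 V)} {e : Sym2 V} :
    Sym2.map g e ∈ permEdges g M ↔ e ∈ M :=
  (Sym2.map.injective g.injective).mem_finset_image

theorem permEdges_one (M : Finset (Sym2 V)) : permEdges 1 M = M := by
  have : Sym2.map (⇑(1 : Perm V)) = id := by rw [Perm.coe_one, Sym2.map_id]
  rw [permEdges, this, Finset.image_id]

theorem permEdges_mul (g h : Perm V) (M : Finset (Sym2 V)) :
    permEdges (g * h) M = permEdges g (permEdges h M) := by
  rw [permEdges, permEdges, permEdges, Finset.image_image]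
  exact Finset.image_congr fun e _ => sym2_map_mul g h e

theorem permEdges_inv_eq {g : Perm V} {M M' : Finset (Sym2 V)} (h : permEdges g M = M') :
    permEdges g⁻¹ M' = M := by
  rw [← h, ← permEdges_mul, inv_mul_cancel, permEdges_one]

theorem card_permEdges (g : Perm V) (M : Finset (Sym2 V)) : (permEdges g M).card = M.card :=
  Finset.card_image_of_injective _ (Sym2.map.injective g.injective)

theorem IsEdgeMatching.permEdges {M : Finset (Sym2 V)} (hM : IsEdgeMatching M) (g : Perm V) :
    IsEdgeMatching (permEdges g M) := by
  refine ⟨fun e he => ?_, fun e he f hf hef v hv hv' => ?_⟩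
  · obtain ⟨e', he', rfl⟩ := mem_permEdges.1 he
    rw [isDiag_sym2_map]
    exact hM.1 e' he'
  · obtain ⟨e', he', rfl⟩ := mem_permEdges.1 he
    obtain ⟨f', hf', rfl⟩ := mem_permEdges.1 hf
    obtain ⟨w, rfl⟩ := g.surjective v
    rw [map_mem_sym2_map] at hv hv'
    exact hM.2 e' he' f' hf' (fun h => hef (h ▸ rfl)) w hv hv'

/-- A permutation that fixes everything but `x, y, a, b` and carries the pair `x, y` to `a, b`. -/
theorem exists_perm_pair {x y a b : V} (hxy : x ≠ y) (hab : a ≠ b) :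
    ∃ τ : Perm V, τ x = a ∧ τ y = b ∧
      ∀ v, v ≠ x → v ≠ y → v ≠ a → v ≠ b → τ v = v := by
  refine ⟨swap (swap x a y) b * swap x a, ?_, ?_, fun v hx hy ha hb => ?_⟩
  · rw [Perm.mul_apply, swap_apply_left, swap_apply_of_ne_of_ne _ hab]
    intro h
    have := (swap x a).injective ((swap_apply_left x a).trans h)
    exact hxy this
  · rw [Perm.mul_apply, swap_apply_left]
  · rw [Perm.mul_apply, swap_apply_of_ne_of_ne hx ha, swap_apply_of_ne_of_ne _ hb]
    intro h
    have h' := (swap x a).injective ((swap_apply_of_ne_of_ne hx ha).trans h)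
    exact hy h'

/-- Any two matchings of the same size are related by a permutation of the vertices. -/
theorem exists_permEdges_eq {X B : Finset (Sym2 V)} (hX : IsEdgeMatching X)
    (hB : IsEdgeMatching B) (hcard : X.card = B.card) : ∃ g : Perm V, permEdges g X = B := by
  suffices H : ∀ d : ℕ, ∀ X : Finset (Sym2 V), IsEdgeMatching X → X.card = B.card →
      (B \ X).card ≤ d → ∃ g : Perm V, permEdges g X = B from H _ X hX hcard le_rfl
  intro d
  induction d with
  | zero =>
    intro X _ hc hd
    have : B ⊆ X := by rwa [Nat.le_zero, Finset.card_eq_zero, Finset.sdiff_eq_empty_iff_subset] at hd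
    exact ⟨1, by rw [permEdges_one, Finset.eq_of_subset_of_card_le this hc.le]⟩
  | succ d ih =>
    intro X hX hc hd
    rcases (B \ X).eq_empty_or_nonempty with h0 | ⟨f, hf⟩
    · exact ih X hX hc (by simp [h0])
    obtain ⟨e, he⟩ : (X \ B).Nonempty := by
      rw [← Finset.card_pos, Finset.card_sdiff_comm hc]
      exact Finset.card_pos.2 ⟨f, hf⟩
    rw [Finset.mem_sdiff] at he hf
    have hed := hX.1 e he.1
    have hfd := hB.1 f hf.1
    induction e with
    | _ x y =>
    induction f with
    | _ a b =>
    rw [Sym2.mk_isDiag_iff] at hed hfd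
    obtain ⟨τ, hτx, hτy, hτ⟩ := exists_perm_pair hed hfd
    -- The common edges avoid `x, y` because `X` is a matching and avoid `a, b` because `B` is one,
    -- so `τ` fixes them while creating a new common edge.
    have hsub : insert s(a, b) (B ∩ X) ⊆ permEdges τ X := by
      intro e' he'
      rw [Finset.mem_insert, Finset.mem_inter] at he'
      rcases he' with rfl | ⟨h1, h2⟩
      · exact mem_permEdges.2 ⟨_, he.1, by rw [Sym2.map_mk, hτx, hτy]⟩
      · refine mem_permEdges.2 ⟨e', h2, sym2_map_eq_self fun v hv => hτ v ?_ ?_ ?_ ?_⟩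
        · rintro rfl; exact he.2 (hX.eq_of_mem h2 he.1 hv (Sym2.mem_mk_left _ _) ▸ h1)
        · rintro rfl; exact he.2 (hX.eq_of_mem h2 he.1 hv (Sym2.mem_mk_right _ _) ▸ h1)
        · rintro rfl; exact hf.2 (hB.eq_of_mem h1 hf.1 hv (Sym2.mem_mk_left _ _) ▸ h2)
        · rintro rfl; exact hf.2 (hB.eq_of_mem h1 hf.1 hv (Sym2.mem_mk_right _ _) ▸ h2)
    have hlt : (B \ permEdges τ X).card < (B \ X).card := by
      refine Finset.card_lt_card ⟨fun e' he' => ?_, fun hss => ?_⟩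
      · rw [Finset.mem_sdiff] at he' ⊢
        exact ⟨he'.1, fun h => he'.2 (hsub (Finset.mem_insert_of_mem (Finset.mem_inter.2 ⟨he'.1, h⟩)))⟩
      · have := hss (Finset.mem_sdiff.2 hf)
        exact (Finset.mem_sdiff.1 this).2 (hsub (Finset.mem_insert_self _ _))
    obtain ⟨g, hg⟩ := ih (permEdges τ X) (hX.permEdges τ) ((card_permEdges τ X).trans hc) (by omega)
    exact ⟨g * τ, by rw [permEdges_mul, hg]⟩

/-! ### Counting matchings. -/

/-- The edges inside the vertex set `W`. -/
def edgesIn (W : Finset V) : Finset (Sym2 V) := W.offDiag.image Sym2.mk.uncurry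

theorem mem_edgesIn {W : Finset V} {e : Sym2 V} :
    e ∈ edgesIn W ↔ ¬ e.IsDiag ∧ ∀ v ∈ e, v ∈ W := by
  induction e with
  | _ a b =>
  simp only [edgesIn, Finset.mem_image, Finset.mem_offDiag, Prod.exists, Function.uncurry_apply_pair,
    Sym2.mk_isDiag_iff, Sym2.mem_iff, forall_eq_or_imp, forall_eq]
  constructor
  · rintro ⟨x, y, ⟨hx, hy, hxy⟩, h⟩
    rcases Sym2.eq_iff.1 h with ⟨rfl, rfl⟩ | ⟨rfl, rfl⟩
    · exact ⟨hxy, hx, hy⟩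
    · exact ⟨hxy.symm, hy, hx⟩
  · rintro ⟨h, ha, hb⟩
    exact ⟨a, b, ⟨ha, hb, h⟩, rfl⟩

open Classical in
/-- The matchings with `r` edges inside the vertex set `W`. -/
noncomputable def matchingsIn (W : Finset V) (r : ℕ) : Finset (Finset (Sym2 V)) :=
  {M ∈ (edgesIn W).powersetCard r | IsEdgeMatching M}

theorem mem_matchingsIn {W : Finset V} {r : ℕ} {M : Finset (Sym2 V)} :
    M ∈ matchingsIn W r ↔ IsEdgeMatching M ∧ M.card = r ∧ ∀ e ∈ M, ∀ v ∈ e, v ∈ W := by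
  simp only [matchingsIn, Finset.mem_filter, Finset.mem_powersetCard, Finset.subset_iff, mem_edgesIn]
  constructor
  · rintro ⟨⟨h1, h2⟩, h3⟩
    exact ⟨h3, h2, fun e he => (h1 he).2⟩
  · rintro ⟨h1, h2, h3⟩
    exact ⟨⟨fun e he => ⟨h1.1 e he, h3 e he⟩, h2⟩, h1⟩

/-- Deleting `e` is a bijection, with inverse inserting it. -/
theorem card_filter_mem_matchingsIn {W : Finset V} {r : ℕ} {e : Sym2 V} (he : e ∈ edgesIn W) :
    ({M ∈ matchingsIn W (r + 1) | e ∈ M}).card = (matchingsIn (W \ e.toFinset) r).card := by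
  rw [mem_edgesIn] at he
  refine Finset.card_nbij' (fun M => M.erase e) (fun M => insert e M) ?_ ?_ ?_ ?_
  · intro M hM
    simp only [Finset.coe_filter, Set.mem_ofPred_eq, mem_matchingsIn, SetLike.mem_coe] at hM ⊢
    obtain ⟨⟨h1, h2, h3⟩, h4⟩ := hM
    refine ⟨h1.subset (Finset.erase_subset _ _), by rw [Finset.card_erase_of_mem h4]; omega, ?_⟩
    intro f hf v hv
    rw [Finset.mem_erase] at hf
    rw [Finset.mem_sdiff, Sym2.mem_toFinset]
    exact ⟨h3 f hf.2 v hv, h1.2 f hf.2 e h4 hf.1 v hv⟩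
  · intro M hM
    simp only [Finset.coe_filter, Set.mem_ofPred_eq, mem_matchingsIn, SetLike.mem_coe,
      Finset.mem_sdiff, Sym2.mem_toFinset] at hM ⊢
    obtain ⟨h1, h2, h3⟩ := hM
    have hn : e ∉ M := fun h => by
      induction e with
      | _ a b => exact (h3 _ h a (Sym2.mem_mk_left _ _)).2 (Sym2.mem_mk_left _ _)
    refine ⟨⟨⟨?_, ?_⟩, by rw [Finset.card_insert_of_notMem hn, h2], ?_⟩,
      Finset.mem_insert_self _ _⟩
    · intro f hf
      rcases Finset.mem_insert.1 hf with rfl | hf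
      exacts [he.1, h1.1 f hf]
    · intro f hf f' hf' hff v hv hv'
      rcases Finset.mem_insert.1 hf with h | h <;> rcases Finset.mem_insert.1 hf' with h' | h'
      · exact hff (h.trans h'.symm)
      · exact (h3 _ h' v hv').2 (h ▸ hv)
      · exact (h3 _ h v hv).2 (h' ▸ hv')
      · exact h1.2 f h f' h' hff v hv hv'
    · intro f hf v hv
      rcases Finset.mem_insert.1 hf with h | h
      exacts [he.2 v (h ▸ hv), (h3 f h v hv).1]
  · intro M hM
    exact Finset.insert_erase (Finset.mem_filter.1 hM).2
  · intro M hM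
    refine Finset.erase_insert fun h => ?_
    have h3 := (mem_matchingsIn.1 hM).2.2 _ h
    induction e with
    | _ a b =>
      have := h3 a (Sym2.mem_mk_left _ _)
      simp at this

theorem sum_card_filter_mem_matchingsIn (W : Finset V) (r : ℕ) :
    ∑ e ∈ edgesIn W, ({M ∈ matchingsIn W r | e ∈ M}).card = (matchingsIn W r).card * r := by
  refine (Finset.sum_card_bipartiteAbove_eq_sum_card_bipartiteBelow
    (fun (M : Finset (Sym2 V)) e => e ∈ M)).symm.trans ?_
  refine Finset.sum_const_nat fun M hM => ?_
  obtain ⟨h1, h2, h3⟩ := mem_matchingsIn.1 hM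
  rw [← h2]
  congr 1
  ext e
  simp only [Finset.bipartiteAbove, Finset.mem_filter, mem_edgesIn]
  exact ⟨fun h => h.2, fun h => ⟨⟨h1.1 e h, h3 e h⟩, h⟩⟩

theorem card_sdiff_toFinset {W : Finset V} {e : Sym2 V} (he : e ∈ edgesIn W) :
    (W \ e.toFinset).card = W.card - 2 := by
  rw [mem_edgesIn] at he
  rw [Finset.card_sdiff_of_subset fun v hv => he.2 v (Sym2.mem_toFinset.1 hv),
    Sym2.card_toFinset_of_not_isDiag e he.1]

/-- Counting incidences of edges and matchings gives the recursion: each of the `W.card.choose 2`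
edges leaves a smaller matching on `W.card - 2` vertices. -/
theorem card_matchingsIn (W : Finset V) (r : ℕ) :
    (matchingsIn W r).card * r.factorial = ∏ i ∈ Finset.range r, (W.card - 2 * i).choose 2 := by
  induction r generalizing W with
  | zero =>
    have : matchingsIn W 0 = {∅} := by
      ext M
      simp only [mem_matchingsIn, Finset.card_eq_zero, Finset.mem_singleton]
      refine ⟨fun h => h.2.1, ?_⟩
      rintro rfl
      simp [IsEdgeMatching]
    simp [this]
  | succ r ih =>
    rw [Nat.factorial_succ, ← mul_assoc, ← sum_card_filter_mem_matchingsIn, Finset.sum_mul,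
      Finset.sum_congr rfl (fun e he => by
        rw [card_filter_mem_matchingsIn he, ih, card_sdiff_toFinset he]),
      Finset.sum_const, smul_eq_mul, edgesIn, Sym2.card_image_offDiag, Finset.prod_range_succ',
      mul_comm]
    simp only [mul_zero, tsub_zero, Nat.sub_sub]
    congr 1
    exact Finset.prod_congr rfl fun i _ => by congr 1; omega

end Matchings

theorem mem_rMatchings {n r : ℕ} {M : Finset (Sym2 (Fin (2 * n)))} :
    M ∈ rMatchings n r ↔ IsEdgeMatching M ∧ M.card = r := by
  simp only [rMatchings, Finset.mem_filter, Finset.mem_powersetCard, IsEdgeMatching,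
    Finset.subset_iff, SimpleGraph.mem_edgeFinset, SimpleGraph.edgeSet_top]
  tauto

theorem rMatchings_eq (n r : ℕ) : rMatchings n r = matchingsIn Finset.univ r := by
  ext M
  simp [mem_rMatchings, mem_matchingsIn]

theorem mem_edgesIn_univ {n : ℕ} {e : Sym2 (Fin (2 * n))} :
    e ∈ edgesIn Finset.univ ↔ e ∈ (⊤ : SimpleGraph (Fin (2 * n))).edgeFinset := by
  simp [mem_edgesIn]

theorem card_matchingStar {n r : ℕ} (hr : 1 ≤ r) {e : Sym2 (Fin (2 * n))}
    (he : e ∈ (⊤ : SimpleGraph (Fin (2 * n))).edgeFinset) :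
    ((matchingStar n r e).card : ℚ) = matchingPhi n r := by
  rw [← mem_edgesIn_univ] at he
  obtain ⟨r, rfl⟩ : ∃ s, r = s + 1 := ⟨r - 1, by omega⟩
  have h := card_matchingsIn (Finset.univ \ e.toFinset) r
  rw [← card_filter_mem_matchingsIn he, ← rMatchings_eq, card_sdiff_toFinset he,
    Finset.card_univ, Fintype.card_fin] at h
  rw [matchingPhi, eq_div_iff (by positivity), Nat.add_sub_cancel, matchingStar]
  have h2 : ∏ i ∈ Finset.Icc 1 r, ((2 * n - 2 * i).choose 2 : ℚ) =
      ((∏ i ∈ Finset.range r, (2 * n - 2 - 2 * i).choose 2 : ℕ) : ℚ) := by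
    rw [Nat.cast_prod, Finset.range_eq_Ico, ← Finset.Ico_add_one_right_eq_Icc]
    refine (Finset.prod_Ico_add' (fun i => (((2 * n - 2 * i).choose 2 : ℕ) : ℚ))
      0 r 1).symm.trans (Finset.prod_congr rfl fun i _ => ?_)
    rw [Nat.sub_sub, show 2 + 2 * i = 2 * (i + 1) by ring]
  rw [h2, ← h]
  push_cast
  rfl

/-- Double counting the pairs of an edge and an `r`-matching through it. -/
theorem card_rMatchings_mul {n r : ℕ} (hr : 1 ≤ r) :
    ((rMatchings n r).card : ℚ) * r = (n * (2 * n - 1) : ℕ) * matchingPhi n r := by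
  have h := sum_card_filter_mem_matchingsIn (Finset.univ : Finset (Fin (2 * n))) r
  rw [← rMatchings_eq] at h
  have h2 : (edgesIn (Finset.univ : Finset (Fin (2 * n)))).card = n * (2 * n - 1) := by
    rw [edgesIn, Sym2.card_image_offDiag, Finset.card_univ, Fintype.card_fin, Nat.choose_two_right,
      mul_assoc, Nat.mul_div_cancel_left _ two_pos]
  have h3 := congrArg (Nat.cast : ℕ → ℚ) h
  rw [Nat.cast_sum, Nat.cast_mul] at h3
  rw [← h3, ← h2, ← nsmul_eq_mul, ← Finset.sum_const]
  exact Finset.sum_congr rfl fun e he => card_matchingStar hr (mem_edgesIn_univ.1 he)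

/-! ### Averaging over all relabellings of a matching cycle. -/

section Cycles

variable {V : Type*} {N : ℕ}

/-- A cyclic ordering of edges in which any `r` consecutive edges form a matching. -/
structure IsMatchingCycle (r : ℕ) (c : ZMod N → Sym2 V) : Prop where
  injective : Function.Injective c
  not_isDiag : ∀ i, ¬ (c i).IsDiag
  disjoint : ∀ i, ∀ k : ℕ, 0 < k → k < r → ∀ v ∈ c i, v ∉ c (i + (k : ZMod N))

theorem IsMatchingCycle.map {r : ℕ} {c : ZMod N → Sym2 V} (hc : IsMatchingCycle r c)
    (g : Perm V) : IsMatchingCycle r fun i => Sym2.map g (c i) where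
  injective := (Sym2.map.injective g.injective).comp hc.injective
  not_isDiag i := by rw [isDiag_sym2_map]; exact hc.not_isDiag i
  disjoint i k hk hkr v hv := by
    obtain ⟨w, rfl⟩ := g.surjective v
    rw [map_mem_sym2_map] at hv ⊢
    exact hc.disjoint i k hk hkr w hv

variable [DecidableEq V]

/-- The set of the `r` edges in the positions `i, ..., i + r - 1`. -/
def edgeWindow (r : ℕ) (c : ZMod N → Sym2 V) (i : ZMod N) : Finset (Sym2 V) :=
  (Finset.range r).image fun k : ℕ => c (i + (k : ZMod N))

theorem mem_edgeWindow {r : ℕ} {c : ZMod N → Sym2 V} {i : ZMod N} {e : Sym2 V} :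
    e ∈ edgeWindow r c i ↔ ∃ k < r, c (i + (k : ZMod N)) = e := by
  simp [edgeWindow]

theorem permEdges_edgeWindow (g : Perm V) (r : ℕ) (c : ZMod N → Sym2 V) (i : ZMod N) :
    permEdges g (edgeWindow r c i) = edgeWindow r (fun j => Sym2.map g (c j)) i := by
  rw [permEdges, edgeWindow, edgeWindow, Finset.image_image]
  rfl

theorem IsMatchingCycle.isEdgeMatching {r : ℕ} {c : ZMod N → Sym2 V} (hc : IsMatchingCycle r c)
    (i : ZMod N) : IsEdgeMatching (edgeWindow r c i) := by
  refine ⟨fun e he => ?_, fun e he f hf hef v hv hv' => ?_⟩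
  · obtain ⟨k, -, rfl⟩ := mem_edgeWindow.1 he
    exact hc.not_isDiag _
  · obtain ⟨k, hk, rfl⟩ := mem_edgeWindow.1 he
    obtain ⟨l, hl, rfl⟩ := mem_edgeWindow.1 hf
    rcases lt_trichotomy k l with h | rfl | h
    · refine hc.disjoint (i + k) (l - k) (by omega) (by omega) v hv ?_
      rwa [Nat.cast_sub h.le, add_assoc, add_sub_cancel]
    · exact hef rfl
    · refine hc.disjoint (i + l) (k - l) (by omega) (by omega) v hv' ?_
      rwa [Nat.cast_sub h.le, add_assoc, add_sub_cancel]

theorem IsMatchingCycle.card_edgeWindow {r : ℕ} {c : ZMod N → Sym2 V} (hc : IsMatchingCycle r c)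
    (hr : r ≤ N) (i : ZMod N) : (edgeWindow r c i).card = r := by
  rw [edgeWindow, Finset.card_image_of_injOn, Finset.card_range]
  intro a ha b hb hab
  simp only [Finset.coe_range, Set.mem_Iio] at ha hb
  exact natCast_zmod_inj (by omega) (by omega) (add_left_cancel (hc.injective hab))

/-- The positions where the cyclic ordering `c`, moved by `g`, has a window belonging to `A`. -/
def windowStarts [NeZero N] (A : Finset (Finset (Sym2 V))) (r : ℕ) (c : ZMod N → Sym2 V)
    (g : Perm V) : Finset (ZMod N) :=
  {i | permEdges g (edgeWindow r c i) ∈ A}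

theorem mem_windowStarts [NeZero N] {A : Finset (Finset (Sym2 V))} {r : ℕ} {c : ZMod N → Sym2 V}
    {g : Perm V} {i : ZMod N} :
    i ∈ windowStarts A r c g ↔ permEdges g (edgeWindow r c i) ∈ A := by
  simp [windowStarts]

theorem IsMatchingCycle.windowsMeet [NeZero N] {r : ℕ} {c : ZMod N → Sym2 V}
    (hc : IsMatchingCycle r c) {A : Finset (Finset (Sym2 V))}
    (hint : (A : Set (Finset (Sym2 V))).Intersecting) (g : Perm V) :
    ∀ x ∈ windowStarts A r c g, ∀ y ∈ windowStarts A r c g, WindowsMeet N r x y := by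
  intro x hx y hy
  rw [mem_windowStarts, permEdges_edgeWindow] at hx hy
  obtain ⟨e, he, he'⟩ := Finset.not_disjoint_iff.1 (hint hx hy)
  obtain ⟨a, ha, rfl⟩ := mem_edgeWindow.1 he
  obtain ⟨b, hb, h⟩ := mem_edgeWindow.1 he'
  exact ⟨a, ha, b, hb, ((hc.map g).injective h).symm⟩

variable [Fintype V]

/-- By transitivity, the permutations carrying `X` to a given `B` form a coset of the stabilizer of
`X`, so all fibres have the same size. Comparing `A` with the family of all matchings eliminates
that size. -/
theorem card_filter_permEdges_mem {r : ℕ} {X : Finset (Sym2 V)}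
    (hX : X ∈ matchingsIn Finset.univ r) {A : Finset (Finset (Sym2 V))}
    (hA : A ⊆ matchingsIn Finset.univ r) :
    (matchingsIn (Finset.univ : Finset V) r).card *
      ({g : Perm V | permEdges g X ∈ A} : Finset (Perm V)).card =
      A.card * Fintype.card (Perm V) := by
  have hX' := mem_matchingsIn.1 hX
  have key : ∀ A ⊆ matchingsIn (Finset.univ : Finset V) r,
      ({g : Perm V | permEdges g X ∈ A} : Finset (Perm V)).card =
        A.card * ({g : Perm V | permEdges g X = X} : Finset (Perm V)).card := by
    intro A hA
    rw [Finset.card_eq_sum_card_fiberwise (f := fun g => permEdges g X) (t := A)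
      (fun g hg => by simpa using hg)]
    refine Finset.sum_const_nat fun B hB => ?_
    have hB' := mem_matchingsIn.1 (hA hB)
    obtain ⟨h, hh⟩ := exists_permEdges_eq hX'.1 hB'.1 (hX'.2.1.trans hB'.2.1.symm)
    refine Finset.card_nbij' (fun g => h⁻¹ * g) (fun g => h * g) ?_ ?_ ?_ ?_
    · intro g hg
      simp only [Finset.mem_coe, Finset.mem_filter, Finset.mem_univ, true_and] at hg ⊢
      rw [permEdges_mul, hg.2, permEdges_inv_eq hh]
    · intro g hg
      simp only [Finset.mem_coe, Finset.mem_filter, Finset.mem_univ, true_and] at hg ⊢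
      rw [permEdges_mul, hg, hh]
      exact ⟨hB, rfl⟩
    · intro g _
      simp
    · intro g _
      simp
  have huniv := key _ subset_rfl
  rw [Finset.filter_true_of_mem, Finset.card_univ] at huniv
  · rw [key A hA, huniv]
    ring
  · intro g _
    exact mem_matchingsIn.2 ⟨hX'.1.permEdges g, (card_permEdges g X).trans hX'.2.1, by simp⟩

theorem IsMatchingCycle.sum_card_windowStarts [NeZero N] {r : ℕ} {c : ZMod N → Sym2 V}
    (hc : IsMatchingCycle r c) (hr : r ≤ N) {A : Finset (Finset (Sym2 V))}
    (hA : A ⊆ matchingsIn Finset.univ r) :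
    (matchingsIn (Finset.univ : Finset V) r).card * ∑ g : Perm V, (windowStarts A r c g).card =
      N * (A.card * Fintype.card (Perm V)) := by
  have h : ∑ g : Perm V, (windowStarts A r c g).card =
      ∑ i : ZMod N, ({g : Perm V | permEdges g (edgeWindow r c i) ∈ A} : Finset (Perm V)).card :=
    Finset.sum_card_bipartiteAbove_eq_sum_card_bipartiteBelow
      (fun (g : Perm V) i => permEdges g (edgeWindow r c i) ∈ A)
  rw [h, Finset.mul_sum, Finset.sum_congr rfl fun i _ => card_filter_permEdges_mem
    (mem_matchingsIn.2 ⟨hc.isEdgeMatching i, hc.card_edgeWindow hr i, by simp⟩) hA,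
    Finset.sum_const, Finset.card_univ, ZMod.card, smul_eq_mul]

theorem IsMatchingCycle.mul_card_le [NeZero N] {r : ℕ} {c : ZMod N → Sym2 V}
    (hc : IsMatchingCycle r c) (hN : 2 * r < N) {A : Finset (Finset (Sym2 V))}
    (hA : A ⊆ matchingsIn Finset.univ r) (hint : (A : Set (Finset (Sym2 V))).Intersecting) :
    N * A.card ≤ (matchingsIn (Finset.univ : Finset V) r).card * r := by
  have h := hc.sum_card_windowStarts (by omega) hA
  have h2 : ∑ g : Perm V, (windowStarts A r c g).card ≤ Fintype.card (Perm V) * r := by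
    refine (Finset.sum_le_card_nsmul _ _ r fun g _ => ?_).trans_eq (by simp [Finset.card_univ])
    exact card_le_of_windowsMeet hN.le _ (hc.windowsMeet hint g)
  refine Nat.le_of_mul_le_mul_right (c := Fintype.card (Perm V)) ?_ Fintype.card_pos
  rw [mul_assoc, ← h, mul_assoc, mul_comm r]
  exact Nat.mul_le_mul_left _ h2

/-- In the extremal case, the windows belonging to `A` are those through a fixed position. -/
theorem IsMatchingCycle.exists_center [NeZero N] {r : ℕ} {c : ZMod N → Sym2 V}
    (hc : IsMatchingCycle r c) (hr : 1 ≤ r) (hN : 2 * r < N) {A : Finset (Finset (Sym2 V))}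
    (hA : A ⊆ matchingsIn Finset.univ r) (hint : (A : Set (Finset (Sym2 V))).Intersecting)
    (hcard : N * A.card = (matchingsIn (Finset.univ : Finset V) r).card * r) (g : Perm V) :
    ∃ p : ZMod N, ∀ i, permEdges g (edgeWindow r c i) ∈ A ↔ ∃ a < r, i + (a : ZMod N) = p := by
  have hle : ∀ g ∈ Finset.univ, (windowStarts A r c g).card ≤ r := fun g _ =>
    card_le_of_windowsMeet hN.le _ (hc.windowsMeet hint g)
  have h := hc.sum_card_windowStarts (by omega) hA
  have hpos : 0 < (matchingsIn (Finset.univ : Finset V) r).card :=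
    Finset.card_pos.2 ⟨_, mem_matchingsIn.2
      ⟨hc.isEdgeMatching 0, hc.card_edgeWindow (by omega) 0, by simp⟩⟩
  -- Every term is at most `r` and the average is `r`, so every term equals `r`.
  have hsum : ∑ g : Perm V, (windowStarts A r c g).card = ∑ _g : Perm V, r := by
    refine Nat.eq_of_mul_eq_mul_left hpos ?_
    rw [h, ← mul_assoc, hcard, Finset.sum_const, smul_eq_mul, Finset.card_univ]
    ring
  have hg := (Finset.sum_eq_sum_iff_of_le hle).1 hsum g (Finset.mem_univ g)
  simpa only [mem_windowStarts] using
    exists_center_of_windowsMeet hr hN _ (hc.windowsMeet hint g) hg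

end Cycles

/-! ### Stabilizers of matchings and the groups generated by swaps. -/

section Swaps

variable {V : Type*} [DecidableEq V]

theorem permEdges_eq_self {g : Perm V} {M : Finset (Sym2 V)} (h : ∀ e ∈ M, Sym2.map g e ∈ M) :
    permEdges g M = M :=
  Finset.eq_of_subset_of_card_le (fun e he => by
    obtain ⟨f, hf, rfl⟩ := mem_permEdges.1 he
    exact h f hf) (card_permEdges g M).ge

theorem IsEdgeMatching.permEdges_swap {M : Finset (Sym2 V)} (hM : IsEdgeMatching M) {x y : V}
    (h : s(x, y) ∈ M) : _root_.permEdges (swap x y) M = M := by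
  refine permEdges_eq_self fun e he => ?_
  by_cases heq : e = s(x, y)
  · rw [heq, Sym2.map_mk, swap_apply_left, swap_apply_right, Sym2.eq_swap]
    exact h
  · rwa [sym2_map_eq_self fun v hv => swap_apply_of_ne_of_ne ?_ ?_]
    · rintro rfl; exact heq (hM.eq_of_mem he h hv (Sym2.mem_mk_left _ _))
    · rintro rfl; exact heq (hM.eq_of_mem he h hv (Sym2.mem_mk_right _ _))

theorem permEdges_swap_of_notMem {M : Finset (Sym2 V)} {x y : V} (hx : ∀ e ∈ M, x ∉ e)
    (hy : ∀ e ∈ M, y ∉ e) : permEdges (swap x y) M = M := by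
  refine permEdges_eq_self fun e he => ?_
  rwa [sym2_map_eq_self fun v hv => swap_apply_of_ne_of_ne ?_ ?_]
  · rintro rfl; exact hx e he hv
  · rintro rfl; exact hy e he hv

theorem IsEdgeMatching.permEdges_swap_mul_swap {M : Finset (Sym2 V)} (hM : IsEdgeMatching M)
    {a b c d : V} (h : s(a, b) ∈ M) (h' : s(c, d) ∈ M) (hne : s(a, b) ≠ s(c, d)) :
    _root_.permEdges (swap a c * swap b d) M = M := by
  have hab : a ≠ b := by simpa using hM.1 _ h
  have hcd : c ≠ d := by simpa using hM.1 _ h'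
  have hac := hM.ne_of_mem h h' hne (Sym2.mem_mk_left _ _) (Sym2.mem_mk_left _ _)
  have had := hM.ne_of_mem h h' hne (Sym2.mem_mk_left _ _) (Sym2.mem_mk_right _ _)
  have hbc := hM.ne_of_mem h h' hne (Sym2.mem_mk_right _ _) (Sym2.mem_mk_left _ _)
  have hbd := hM.ne_of_mem h h' hne (Sym2.mem_mk_right _ _) (Sym2.mem_mk_right _ _)
  refine permEdges_eq_self fun e he => ?_
  by_cases h1 : e = s(a, b)
  · rw [h1, Sym2.map_mk, Perm.mul_apply, Perm.mul_apply, swap_apply_of_ne_of_ne hab had,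
      swap_apply_left, swap_apply_left, swap_apply_of_ne_of_ne had.symm hcd.symm]
    exact h'
  by_cases h2 : e = s(c, d)
  · rw [h2, Sym2.map_mk, Perm.mul_apply, Perm.mul_apply, swap_apply_of_ne_of_ne hbc.symm hcd,
      swap_apply_right, swap_apply_right, swap_apply_of_ne_of_ne hab.symm hbc]
    exact h
  · rwa [sym2_map_eq_self fun v hv => ?_]
    have va := hM.ne_of_mem he h h1 hv (Sym2.mem_mk_left _ _)
    have vb := hM.ne_of_mem he h h1 hv (Sym2.mem_mk_right _ _)
    have vc := hM.ne_of_mem he h' h2 hv (Sym2.mem_mk_left _ _)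
    have vd := hM.ne_of_mem he h' h2 hv (Sym2.mem_mk_right _ _)
    rw [Perm.mul_apply, swap_apply_of_ne_of_ne vb vd, swap_apply_of_ne_of_ne va vc]

/-- If `K` contains the swaps along the edges of a matching `P`, the permutations exchanging two
edges of `P` and one more swap at a vertex of `P`, it contains all swaps of vertices of `P`. -/
theorem swap_mem_of_link {K : Subgroup (Perm V)} {P : Finset (Sym2 V)} (hP : IsEdgeMatching P)
    (h₁ : ∀ a b, s(a, b) ∈ P → swap a b ∈ K)
    (h₂ : ∀ a b c d, s(a, b) ∈ P → s(c, d) ∈ P → s(a, b) ≠ s(c, d) → swap a c * swap b d ∈ K)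
    {x y w : V} (hxy : s(x, y) ∈ P) (hwx : w ≠ x) (hwy : w ≠ y) (hw : swap x w ∈ K)
    {z z' : V} (hz : ∃ e ∈ P, z ∈ e) (hz' : ∃ e ∈ P, z' ∈ e) : swap z z' ∈ K := by
  have key : ∀ z, (∃ e ∈ P, z ∈ e) → swap x z ∈ K := by
    rintro z ⟨e, he, hze⟩
    obtain ⟨u, rfl⟩ := Sym2.mem_iff_exists.1 hze
    by_cases heq : s(x, y) = s(z, u)
    · rcases Sym2.eq_iff.1 heq with ⟨rfl, -⟩ | ⟨-, rfl⟩
      · rw [swap_self]; exact K.one_mem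
      · exact h₁ _ _ hxy
    by_cases hwz : w = z
    · rwa [← hwz]
    by_cases hwu : w = u
    · subst hwu
      exact SubmonoidClass.swap_mem_trans K hw (swap_comm z w ▸ h₁ z w he)
    have hτ := h₂ x y z u hxy he heq
    have hxu := hP.ne_of_mem hxy he heq (Sym2.mem_mk_left _ _) (Sym2.mem_mk_right _ _)
    have hxy' : x ≠ y := by simpa using hP.1 _ hxy
    -- Conjugation by the exchange of the two edges turns `swap x w` into `swap z w`, since `w` lies
    -- on neither edge.
    have hconj := K.mul_mem (K.mul_mem hτ hw) (K.inv_mem hτ)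
    rw [← swap_apply_apply, Perm.mul_apply, Perm.mul_apply, swap_apply_of_ne_of_ne hxy' hxu,
      swap_apply_left, swap_apply_of_ne_of_ne hwy hwu, swap_apply_of_ne_of_ne hwx hwz] at hconj
    exact SubmonoidClass.swap_mem_trans K hw (swap_comm z w ▸ hconj)
  exact SubmonoidClass.swap_mem_trans K (swap_comm x z ▸ key z hz) (key z' hz')

/-- A matching with at least two edges can be moved off any other matching by swaps inside a set
that contains its vertices. -/
theorem exists_permEdges_disjoint {K : Subgroup (Perm V)} {U : Set V}
    (hK : ∀ x ∈ U, ∀ y ∈ U, swap x y ∈ K) {B : Finset (Sym2 V)} (hB : IsEdgeMatching B)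
    {P : Finset (Sym2 V)} (hP : IsEdgeMatching P) (hPU : ∀ e ∈ P, ∀ v ∈ e, v ∈ U)
    (hcard : 2 ≤ P.card) :
    ∃ h ∈ K, (∀ v ∉ U, h v = v) ∧ ∀ e ∈ P, Sym2.map h e ∉ B := by
  suffices H : ∀ d : ℕ, ∀ P : Finset (Sym2 V), IsEdgeMatching P → (∀ e ∈ P, ∀ v ∈ e, v ∈ U) →
      2 ≤ P.card → (P ∩ B).card ≤ d →
      ∃ h ∈ K, (∀ v ∉ U, h v = v) ∧ ∀ e ∈ P, Sym2.map h e ∉ B from H _ P hP hPU hcard le_rfl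
  intro d
  induction d with
  | zero =>
    intro P _ _ _ hd
    refine ⟨1, K.one_mem, fun v _ => rfl, fun e he heB => ?_⟩
    rw [Nat.le_zero, Finset.card_eq_zero] at hd
    rw [Perm.coe_one, Sym2.map_id] at heB
    exact Finset.notMem_empty e (hd ▸ Finset.mem_inter.2 ⟨he, heB⟩)
  | succ d ih =>
    intro P hP hPU hcard hd
    rcases (P ∩ B).eq_empty_or_nonempty with h0 | ⟨e, he⟩
    · exact ih P hP hPU hcard (by simp [h0])
    rw [Finset.mem_inter] at he
    obtain ⟨f, hf, hfe⟩ := Finset.exists_mem_ne (s := P) (by omega) e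
    induction e with
    | _ a b =>
    induction f with
    | _ a' b' =>
    have hne := hfe.symm
    have hab : a ≠ b := by simpa using hP.1 _ he.1
    have hab' : a' ≠ b' := by simpa using hP.1 _ hf
    have haa := hP.ne_of_mem he.1 hf hne (Sym2.mem_mk_left _ _) (Sym2.mem_mk_left _ _)
    have hab'' := hP.ne_of_mem he.1 hf hne (Sym2.mem_mk_left _ _) (Sym2.mem_mk_right _ _)
    have hba := hP.ne_of_mem he.1 hf hne (Sym2.mem_mk_right _ _) (Sym2.mem_mk_left _ _)
    have hbb := hP.ne_of_mem he.1 hf hne (Sym2.mem_mk_right _ _) (Sym2.mem_mk_right _ _)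
    have hbU := hPU _ he.1 b (Sym2.mem_mk_right _ _)
    have haU' := hPU _ hf a' (Sym2.mem_mk_left _ _)
    -- The swap turns `s(a, b)`, `s(a', b')` into `s(a, a')`, `s(b, b')`. Neither is in `B`, where
    -- `a` and `b` are already matched to each other; the other edges do not move.
    have hlt : (permEdges (swap b a') P ∩ B).card < (P ∩ B).card := by
      refine Finset.card_lt_card (Finset.ssubset_of_subset_of_ssubset ?_
        (Finset.erase_ssubset (Finset.mem_inter.2 he)))
      intro e' he'
      rw [Finset.mem_inter, mem_permEdges] at he'
      obtain ⟨⟨e, heP, rfl⟩, heB⟩ := he'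
      by_cases h1 : e = s(a, b)
      · rw [h1, Sym2.map_mk, swap_apply_left, swap_apply_of_ne_of_ne hab haa] at heB
        have := hB.eq_of_mem heB he.2 (Sym2.mem_mk_left _ _) (Sym2.mem_mk_left _ _)
        simp only [Sym2.congr_right] at this
        exact absurd this hba.symm
      by_cases h2 : e = s(a', b')
      · rw [h2, Sym2.map_mk, swap_apply_right, swap_apply_of_ne_of_ne hbb.symm hab'.symm] at heB
        have := hB.eq_of_mem heB he.2 (Sym2.mem_mk_left _ _) (Sym2.mem_mk_right _ _)
        rw [Sym2.eq_swap, Sym2.congr_left] at this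
        exact absurd this hab''.symm
      · rw [sym2_map_eq_self fun v hv => swap_apply_of_ne_of_ne
          (hP.ne_of_mem heP he.1 h1 hv (Sym2.mem_mk_right _ _))
          (hP.ne_of_mem heP hf h2 hv (Sym2.mem_mk_left _ _))] at heB ⊢
        exact Finset.mem_erase.2 ⟨h1, Finset.mem_inter.2 ⟨heP, heB⟩⟩
    obtain ⟨h, hhK, hhU, hh⟩ := ih (permEdges (swap b a') P) (hP.permEdges _) (by
      intro e he v hv
      obtain ⟨e', he', rfl⟩ := mem_permEdges.1 he
      obtain ⟨u, hu, rfl⟩ := Sym2.mem_map.1 hv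
      have := hPU e' he' u hu
      rw [swap_apply_def]
      split_ifs <;> assumption) (by rwa [card_permEdges]) (by omega)
    refine ⟨h * swap b a', K.mul_mem hhK (hK b hbU a' haU'), fun v hv => ?_, fun e he => ?_⟩
    · rw [Perm.mul_apply, swap_apply_of_ne_of_ne, hhU v hv]
      · rintro rfl; exact hv hbU
      · rintro rfl; exact hv haU'
    · rw [sym2_map_mul]
      exact hh _ (map_mem_permEdges.2 he)

end Swaps

/-! ### Permutations preserving the center, and the extremal families. -/

section Centers

variable {V : Type*} [DecidableEq V] {N : ℕ}

/-- The windows of the cyclic ordering `c`, moved by `g`, that belong to `A` are exactly those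
through the position `p`. -/
def IsCenter (A : Finset (Finset (Sym2 V))) (r : ℕ) (c : ZMod N → Sym2 V) (p : ZMod N)
    (g : Perm V) : Prop :=
  ∀ i, permEdges g (edgeWindow r c i) ∈ A ↔ ∃ a < r, i + (a : ZMod N) = p

/-- The permutations that preserve the property of having the center in position `p`. -/
def centerSubgroup (A : Finset (Finset (Sym2 V))) (r : ℕ) (c : ZMod N → Sym2 V) (p : ZMod N) :
    Subgroup (Perm V) where
  -- Multiplication is on the right: `h` acts before the relabelling `g`, so if it stabilizes a
  -- window of `c`, then `g` and `g * h` send that window to the same matching.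
  carrier := {h | ∀ g, IsCenter A r c p g ↔ IsCenter A r c p (g * h)}
  one_mem' g := by rw [mul_one]
  mul_mem' {h h'} hh hh' g := by rw [hh g, hh' (g * h), mul_assoc]
  inv_mem' {h} hh g := by rw [hh (g * h⁻¹), inv_mul_cancel_right]

variable {A : Finset (Finset (Sym2 V))} {r : ℕ} {c : ZMod N → Sym2 V}

theorem mem_centerSubgroup_of_forall {p : ZMod N} {h : Perm V}
    (H : ∀ g, IsCenter A r c p g → IsCenter A r c p (g * h))
    (H' : ∀ g, IsCenter A r c p g → IsCenter A r c p (g * h⁻¹)) :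
    h ∈ centerSubgroup A r c p := fun g =>
  ⟨H g, fun hg => by simpa using H' _ hg⟩

/-- Two adjacent windows, of which one belongs to `A` and the other does not, determine the center:
the case of the last window through the center. -/
theorem mem_centerSubgroup_of_next (hcen : ∀ g, ∃ p, IsCenter A r c p g) (hr : 1 ≤ r)
    (hN : 2 * r < N) {p : ZMod N} {h : Perm V}
    (h₁ : permEdges h (edgeWindow r c p) = edgeWindow r c p)
    (h₂ : permEdges h (edgeWindow r c (p + 1)) = edgeWindow r c (p + 1)) :
    h ∈ centerSubgroup A r c p := by
  have key : ∀ h : Perm V, permEdges h (edgeWindow r c p) = edgeWindow r c p →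
      permEdges h (edgeWindow r c (p + 1)) = edgeWindow r c (p + 1) →
      ∀ g, IsCenter A r c p g → IsCenter A r c p (g * h) := by
    intro h h₁ h₂ g hg
    obtain ⟨q, hq⟩ := hcen (g * h)
    suffices q = p by rwa [this] at hq
    have e₁ := (hg p).2 ⟨0, by omega, by simp⟩
    rw [← h₁, ← permEdges_mul, hq] at e₁
    obtain ⟨a, ha, rfl⟩ := e₁
    have e₂ : ¬ permEdges g (edgeWindow r c (p + 1)) ∈ A := by
      rw [hg]
      rintro ⟨b, hb, hb'⟩
      have : ((b + 1 : ℕ) : ZMod N) = (0 : ℕ) := by push_cast; linear_combination hb'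
      -- The window at `p + 1` reaches `p` only after a full turn, as `b + 1 ≤ r < N`.
      have := natCast_zmod_inj (by omega) (by omega) this
      omega
    rw [← h₂, ← permEdges_mul, hq] at e₂
    rcases Nat.eq_zero_or_pos a with rfl | hpos
    · simp
    · refine absurd ⟨a - 1, by omega, ?_⟩ e₂
      rw [Nat.cast_sub hpos]; push_cast; ring
  exact mem_centerSubgroup_of_forall (key h h₁ h₂)
    (key h⁻¹ (permEdges_inv_eq h₁) (permEdges_inv_eq h₂))

/-- Two adjacent windows, of which one belongs to `A` and the other does not, determine the center:
the case of the first window through the center. -/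
theorem mem_centerSubgroup_of_prev (hcen : ∀ g, ∃ p, IsCenter A r c p g) (hr : 1 ≤ r)
    (hN : 2 * r < N) {p : ZMod N} {h : Perm V}
    (h₁ : permEdges h (edgeWindow r c (p - r)) = edgeWindow r c (p - r))
    (h₂ : permEdges h (edgeWindow r c (p - r + 1)) = edgeWindow r c (p - r + 1)) :
    h ∈ centerSubgroup A r c p := by
  have key : ∀ h : Perm V, permEdges h (edgeWindow r c (p - r)) = edgeWindow r c (p - r) →
      permEdges h (edgeWindow r c (p - r + 1)) = edgeWindow r c (p - r + 1) →
      ∀ g, IsCenter A r c p g → IsCenter A r c p (g * h) := by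
    intro h h₁ h₂ g hg
    obtain ⟨q, hq⟩ := hcen (g * h)
    suffices q = p by rwa [this] at hq
    have e₁ := (hg (p - r + 1)).2 ⟨r - 1, by omega, by rw [Nat.cast_sub hr]; push_cast; ring⟩
    rw [← h₂, ← permEdges_mul, hq] at e₁
    obtain ⟨a, ha, rfl⟩ := e₁
    have e₂ : ¬ permEdges g (edgeWindow r c (p - r)) ∈ A := by
      rw [hg]
      rintro ⟨b, hb, hb'⟩
      have : (b : ZMod N) = (r : ℕ) := by linear_combination hb'
      have := natCast_zmod_inj (by omega) (by omega) this
      omega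
    rw [← h₁, ← permEdges_mul, hq] at e₂
    by_cases har : a + 1 = r
    · rw [← har]; push_cast; ring
    · refine absurd ⟨a + 1, by omega, ?_⟩ e₂
      push_cast; ring
  exact mem_centerSubgroup_of_forall (key h h₁ h₂)
    (key h⁻¹ (permEdges_inv_eq h₁) (permEdges_inv_eq h₂))

/-- If every relabelling of a matching cycle has a center with respect to an intersecting family
`A` of matchings of size at least three, then all members of `A` contain the central edge. -/
theorem IsMatchingCycle.center_mem (hc : IsMatchingCycle r c)
    (hcen : ∀ g, ∃ p, IsCenter A r c p g) (hr : 3 ≤ r) (hN : 2 * r < N)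
    (hint : (A : Set (Finset (Sym2 V))).Intersecting) {p : ZMod N} (hp : IsCenter A r c p 1)
    {B : Finset (Sym2 V)} (hB : IsEdgeMatching B) (hBA : B ∈ A) : c p ∈ B := by
  by_contra hpB
  set K := centerSubgroup A r c p with hK
  -- `P` is common to the windows at `p` and `p + 1`, and `Q` to those at `p - r` and `p - r + 1`.
  -- Each of these two pairs locates the center `p`, from opposite sides.
  set P := edgeWindow (r - 1) c (p + 1) with hPdef
  set Q := edgeWindow (r - 1) c (p - r + 1) with hQdef
  have hP₁ : P ⊆ edgeWindow r c p := by
    intro e he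
    obtain ⟨k, hk, rfl⟩ := mem_edgeWindow.1 he
    exact mem_edgeWindow.2 ⟨k + 1, by omega, by congr 1; push_cast; ring⟩
  have hP₂ : P ⊆ edgeWindow r c (p + 1) := by
    intro e he
    obtain ⟨k, hk, rfl⟩ := mem_edgeWindow.1 he
    exact mem_edgeWindow.2 ⟨k, by omega, rfl⟩
  have hQ₁ : Q ⊆ edgeWindow r c (p - r) := by
    intro e he
    obtain ⟨k, hk, rfl⟩ := mem_edgeWindow.1 he
    exact mem_edgeWindow.2 ⟨k + 1, by omega, by congr 1; push_cast; ring⟩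
  have hQ₂ : Q ⊆ edgeWindow r c (p - r + 1) := by
    intro e he
    obtain ⟨k, hk, rfl⟩ := mem_edgeWindow.1 he
    exact mem_edgeWindow.2 ⟨k, by omega, rfl⟩
  have hpw : ∀ e ∈ edgeWindow r c p, e = c p ∨ e ∈ P := by
    intro e he
    obtain ⟨k, hk, rfl⟩ := mem_edgeWindow.1 he
    rcases Nat.eq_zero_or_pos k with rfl | hpos
    · simp
    · exact Or.inr (mem_edgeWindow.2 ⟨k - 1, by omega, by
        rw [Nat.cast_sub hpos]; congr 1; push_cast; ring⟩)
  have hqw : ∀ e ∈ edgeWindow r c (p - r), e = c (p - r) ∨ e ∈ Q := by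
    intro e he
    obtain ⟨k, hk, rfl⟩ := mem_edgeWindow.1 he
    rcases Nat.eq_zero_or_pos k with rfl | hpos
    · simp
    · exact Or.inr (mem_edgeWindow.2 ⟨k - 1, by omega, by
        rw [Nat.cast_sub hpos]; congr 1; push_cast; ring⟩)
  have hqw' : ∀ e ∈ edgeWindow r c (p - r + 1), e = c p ∨ e ∈ Q := by
    intro e he
    obtain ⟨k, hk, rfl⟩ := mem_edgeWindow.1 he
    rcases Nat.lt_or_ge k (r - 1) with h | h
    · exact Or.inr (mem_edgeWindow.2 ⟨k, h, rfl⟩)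
    · obtain rfl : k = r - 1 := by omega
      left; rw [Nat.cast_sub (by omega)]; congr 1; push_cast; ring
  have hcp : c p ∈ edgeWindow r c p := mem_edgeWindow.2 ⟨0, by omega, by simp⟩
  have hM := hc.isEdgeMatching p
  have hPm : IsEdgeMatching P := hM.subset hP₁
  have hPcard : P.card = r - 1 := by
    have : IsMatchingCycle (r - 1) c :=
      ⟨hc.injective, hc.not_isDiag, fun i k h h' => hc.disjoint i k h (by omega)⟩
    exact this.card_edgeWindow (by omega) _
  have hne : ∀ k < r, ∀ e ∈ P, e ≠ c (p - r + (k : ZMod N)) := by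
    intro k hk e he heq
    obtain ⟨l, hl, rfl⟩ := mem_edgeWindow.1 he
    have h1 := hc.injective heq
    have h2 : ((r + 1 + l : ℕ) : ZMod N) = (k : ℕ) := by push_cast; linear_combination h1
    have := natCast_zmod_inj (by omega) (by omega) h2
    omega
  have hPp : ∀ e ∈ P, ∀ v ∈ e, v ∉ c p := by
    intro e he v hv hv'
    have h1 := hM.eq_of_mem (hP₁ he) hcp hv hv'
    obtain ⟨l, hl, rfl⟩ := mem_edgeWindow.1 he
    have h2 : ((l + 1 : ℕ) : ZMod N) = (0 : ℕ) := by
      push_cast; linear_combination hc.injective h1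
    have := natCast_zmod_inj (by omega) (by omega) h2
    omega
  have hKP : ∀ h : Perm V, permEdges h (edgeWindow r c p) = edgeWindow r c p →
      permEdges h (edgeWindow r c (p + 1)) = edgeWindow r c (p + 1) → h ∈ K :=
    fun h h₁ h₂ => mem_centerSubgroup_of_next hcen (by omega) hN h₁ h₂
  have hKQ : ∀ h : Perm V, permEdges h (edgeWindow r c (p - r)) = edgeWindow r c (p - r) →
      permEdges h (edgeWindow r c (p - r + 1)) = edgeWindow r c (p - r + 1) → h ∈ K :=
    fun h h₁ h₂ => mem_centerSubgroup_of_prev hcen (by omega) hN h₁ h₂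
  -- If `x` is also a vertex of an edge of `Q`, the swap along that edge stabilizes both earlier
  -- windows. Its other end is off the edge in `P`, because `P` and `Q` occupy different positions.
  have hlinkQ : ∀ e ∈ P, ∀ x ∈ e, ∀ f ∈ Q, x ∈ f →
      ∃ x y w : V, s(x, y) ∈ P ∧ w ≠ x ∧ w ≠ y ∧ swap x w ∈ K := by
    intro e he x hx f hf hxf
    obtain ⟨y, rfl⟩ := Sym2.mem_iff_exists.1 hx
    obtain ⟨w, rfl⟩ := Sym2.mem_iff_exists.1 hxf
    refine ⟨x, y, w, he, ?_, ?_, hKQ _ ((hc.isEdgeMatching _).permEdges_swap (hQ₁ hf))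
      ((hc.isEdgeMatching _).permEdges_swap (hQ₂ hf))⟩
    · rintro rfl
      exact (hc.isEdgeMatching _).1 _ (hQ₁ hf) rfl
    · rintro rfl
      obtain ⟨k, hk, hk'⟩ := mem_edgeWindow.1 (hQ₁ hf)
      exact hne k hk _ he hk'.symm
  -- The swaps from the later windows preserve the edge structure of `P`; one swap breaking it comes
  -- from the earlier windows. Two edges of `P` each have a vertex off `c (p - r)`. If either vertex
  -- is on `Q`, `hlinkQ` applies; otherwise both avoid the earlier windows, so swapping them changes
  -- neither.
  have hlink : ∃ x y w : V, s(x, y) ∈ P ∧ w ≠ x ∧ w ≠ y ∧ swap x w ∈ K := by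
    have hex : ∀ e ∈ P, ∃ x ∈ e, x ∉ c (p - r) := by
      intro e he
      by_contra! hcon
      refine hne 0 (by omega) e he ?_
      rw [Nat.cast_zero, add_zero]
      have hd := hPm.1 e he
      induction e with
      | _ a b =>
      exact ((Sym2.mem_and_mem_iff (by simpa using hd)).1
        ⟨hcon a (Sym2.mem_mk_left _ _), hcon b (Sym2.mem_mk_right _ _)⟩).symm
    obtain ⟨e, he, f, hf, hef⟩ := Finset.one_lt_card.1 (show 1 < P.card by omega)
    obtain ⟨x, hx, hxc⟩ := hex e he
    obtain ⟨y, hy, hyc⟩ := hex f hf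
    by_cases hxQ : ∃ f ∈ Q, x ∈ f
    · obtain ⟨f', hf', hxf'⟩ := hxQ
      exact hlinkQ e he x hx f' hf' hxf'
    by_cases hyQ : ∃ f ∈ Q, y ∈ f
    · obtain ⟨f', hf', hyf'⟩ := hyQ
      exact hlinkQ f hf y hy f' hf' hyf'
    push Not at hxQ hyQ
    have hout : ∀ z, z ∉ c (p - r) → z ∉ c p → (∀ f ∈ Q, z ∉ f) →
        (∀ e ∈ edgeWindow r c (p - r), z ∉ e) ∧ ∀ e ∈ edgeWindow r c (p - r + 1), z ∉ e := by
      intro z h1 h2 h3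
      refine ⟨fun e he => ?_, fun e he => ?_⟩
      · rcases hqw e he with rfl | h
        exacts [h1, h3 e h]
      · rcases hqw' e he with rfl | h
        exacts [h2, h3 e h]
    obtain ⟨x₁, x₂⟩ := hout x hxc (hPp e he x hx) hxQ
    obtain ⟨y₁, y₂⟩ := hout y hyc (hPp f hf y hy) hyQ
    obtain ⟨x', rfl⟩ := Sym2.mem_iff_exists.1 hx
    exact ⟨x, x', y, he, hPm.ne_of_mem hf he hef.symm hy (Sym2.mem_mk_left _ _),
      hPm.ne_of_mem hf he hef.symm hy (Sym2.mem_mk_right _ _),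
      hKQ _ (permEdges_swap_of_notMem x₁ y₁) (permEdges_swap_of_notMem x₂ y₂)⟩
  obtain ⟨x, y, w, hxy, hwx, hwy, hw⟩ := hlink
  have hM' := hc.isEdgeMatching (p + 1)
  have hswap : ∀ z ∈ {z : V | ∃ e ∈ P, z ∈ e}, ∀ z' ∈ {z : V | ∃ e ∈ P, z ∈ e}, swap z z' ∈ K :=
    fun z hz z' hz' => swap_mem_of_link hPm
      (fun a b hab => hKP _ (hM.permEdges_swap (hP₁ hab)) (hM'.permEdges_swap (hP₂ hab)))
      (fun a b a' b' h h' hab => hKP _ (hM.permEdges_swap_mul_swap (hP₁ h) (hP₁ h') hab)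
        (hM'.permEdges_swap_mul_swap (hP₂ h) (hP₂ h') hab)) hxy hwx hwy hw hz hz'
  obtain ⟨h, hhK, hhU, hh⟩ := exists_permEdges_disjoint hswap hB hPm
    (fun e he v hv => ⟨e, he, hv⟩) (by omega)
  -- The identity has center `p` and `h` lies in `K`, so the window at `p` moved by `h` is in `A`.
  -- It consists of the unmoved edge `c p` and the image of `P`, both avoiding `B`.
  have hcenter : IsCenter A r c p h := by simpa using (hhK 1).1 hp
  have hmem : permEdges h (edgeWindow r c p) ∈ A := (hcenter p).2 ⟨0, by omega, by simp⟩
  obtain ⟨e, he, heB⟩ := Finset.not_disjoint_iff.1 (hint hmem hBA)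
  obtain ⟨e', he', rfl⟩ := mem_permEdges.1 he
  rcases hpw e' he' with rfl | h'
  · rw [sym2_map_eq_self fun v hv => hhU v ?_] at heB
    · exact hpB heB
    · rintro ⟨f, hf, hvf⟩
      exact hPp f hf v hvf hv
  · exact hh e' h' heB

/-- An intersecting family of pairs that contains a triangle has at most three members. -/
theorem card_le_three_of_triangle {α : Type*} [DecidableEq α] {A : Finset (Finset α)}
    (hA : ∀ M ∈ A, M.card = 2) (hint : (A : Set (Finset α)).Intersecting) {x y z : α}
    (hxy : {x, y} ∈ A) (hxz : {x, z} ∈ A) (hyz : {y, z} ∈ A) : A.card ≤ 3 := by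
  have hsub : A ⊆ ({x, y, z} : Finset α).powersetCard 2 := by
    intro M hM
    have hM2 := hA M hM
    have h1 := hint hM hxy
    have h2 := hint hM hxz
    have h3 := hint hM hyz
    have n1 := hA _ hxy
    have n2 := hA _ hxz
    have n3 := hA _ hyz
    rw [Finset.card_eq_two] at hM2
    obtain ⟨a, b, hab, rfl⟩ := hM2
    rw [Finset.mem_powersetCard]
    refine ⟨?_, Finset.card_pair hab⟩
    simp only [Finset.disjoint_left] at h1 h2 h3
    intro u hu
    simp only [Finset.mem_insert, Finset.mem_singleton] at *
    by_cases hxy' : x = y <;> by_cases hxz' : x = z <;> by_cases hyz' : y = z <;> grind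
  refine (Finset.card_le_card hsub).trans ?_
  rw [Finset.card_powersetCard]
  exact (Nat.choose_le_choose 2 Finset.card_le_three).trans (by decide)

end Centers

/-! ### The bound and the extremal families. -/

theorem theorem2 (n r : ℕ) (hr : 1 ≤ r) (hrn : r < n)
    (𝒜 : Finset (Finset (Sym2 (Fin (2 * n))))) (h𝒜 : 𝒜 ⊆ rMatchings n r)
    (hint : (𝒜 : Set (Finset (Sym2 (Fin (2 * n))))).Intersecting) :
    (𝒜.card : ℚ) ≤ matchingPhi n r ∧
      ((𝒜.card : ℚ) = matchingPhi n r ↔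
        ∃ e ∈ (⊤ : SimpleGraph (Fin (2 * n))).edgeFinset, 𝒜 = matchingStar n r e) := by
  obtain ⟨c, hinj, hdiag, hdisj⟩ := exists_cyclic_ordering (n := n) (by omega)
  have hc : IsMatchingCycle r c :=
    ⟨hinj, hdiag, fun i k hk hkr => hdisj i k hk (by omega)⟩
  have hN : 2 * r < n * (2 * n - 1) := by
    have : 2 * (2 * n - 1) ≤ n * (2 * n - 1) := Nat.mul_le_mul_right _ (by omega)
    omega
  have : NeZero (n * (2 * n - 1)) := ⟨by omega⟩
  have hNpos : (0 : ℚ) < (n * (2 * n - 1) : ℕ) := by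
    exact_mod_cast (by omega : 0 < n * (2 * n - 1))
  have hA := h𝒜
  rw [rMatchings_eq] at hA
  have hcount := card_rMatchings_mul (n := n) hr
  refine ⟨?_, fun heq => ?_, ?_⟩
  · have h := hc.mul_card_le hN hA hint
    rw [← rMatchings_eq] at h
    have h' : ((n * (2 * n - 1) : ℕ) : ℚ) * 𝒜.card ≤ (rMatchings n r).card * r := by
      exact_mod_cast h
    rw [hcount] at h'
    exact le_of_mul_le_mul_left h' hNpos
  · have hcard : n * (2 * n - 1) * 𝒜.card =
        (matchingsIn (Finset.univ : Finset (Fin (2 * n))) r).card * r := by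
      rw [← heq, rMatchings_eq] at hcount
      exact_mod_cast hcount.symm
    have hcen : ∀ g, ∃ p, IsCenter 𝒜 r c p g := hc.exists_center hr hN hA hint hcard
    obtain ⟨p, hp⟩ := hcen 1
    have hwin : ∀ i, (∃ a < r, i + (a : ZMod (n * (2 * n - 1))) = p) → edgeWindow r c i ∈ 𝒜 :=
      fun i hi => by simpa only [permEdges_one] using (hp i).2 hi
    have he : c p ∈ (⊤ : SimpleGraph (Fin (2 * n))).edgeFinset := by
      simpa using hdiag p
    have hmem : ∀ B ∈ 𝒜, c p ∈ B := by
      intro B hB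
      -- For `r = 1` the window at `p` is just `{c p}`. For `r = 2`, a member missing `c p` must be
      -- `{c (p + 1), c (p - 1)}`, closing a triangle with the two windows through `p`.
      rcases (by omega : r = 1 ∨ r = 2 ∨ 3 ≤ r) with rfl | rfl | h3
      · obtain ⟨e, he, heB⟩ :=
          Finset.not_disjoint_iff.1 (hint (hwin p ⟨0, by omega, by simp⟩) hB)
        simp only [edgeWindow, Finset.range_one, Finset.image_singleton, Nat.cast_zero, add_zero,
          Finset.mem_singleton] at he
        rwa [← he]
      · by_contra hpB
        have w1 := hwin p ⟨0, by omega, by simp⟩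
        have w2 := hwin (p - 1) ⟨1, by omega, by simp⟩
        have e1 : edgeWindow 2 c p = {c p, c (p + 1)} := by
          ext e; simp [mem_edgeWindow, Nat.le_one_iff_eq_zero_or_eq_one, eq_comm]
        have e2 : edgeWindow 2 c (p - 1) = {c p, c (p - 1)} := by
          ext e
          simp [mem_edgeWindow, Nat.le_one_iff_eq_zero_or_eq_one, eq_comm, or_comm]
        rw [e1] at w1
        rw [e2] at w2
        have hB2 : B.card = 2 := (mem_rMatchings.1 (h𝒜 hB)).2
        have hB1 : c (p + 1) ∈ B := by
          obtain ⟨e, he, heB⟩ := Finset.not_disjoint_iff.1 (hint w1 hB)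
          rcases (by simpa using he : e = c p ∨ e = c (p + 1)) with rfl | rfl
          exacts [absurd heB hpB, heB]
        have hB1' : c (p - 1) ∈ B := by
          obtain ⟨e, he, heB⟩ := Finset.not_disjoint_iff.1 (hint w2 hB)
          rcases (by simpa using he : e = c p ∨ e = c (p - 1)) with rfl | rfl
          exacts [absurd heB hpB, heB]
        have hne : c (p + 1) ≠ c (p - 1) := by
          intro h
          have h2 : ((2 : ℕ) : ZMod (n * (2 * n - 1))) = (0 : ℕ) := by
            push_cast; linear_combination hinj h
          have := natCast_zmod_inj (by omega) (by omega) h2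
          omega
        have hBeq : {c (p + 1), c (p - 1)} = B :=
          Finset.eq_of_subset_of_card_le (by
            rw [Finset.insert_subset_iff, Finset.singleton_subset_iff]
            exact ⟨hB1, hB1'⟩) (by rw [hB2, Finset.card_pair hne])
        have h3 := card_le_three_of_triangle (fun M hM => (mem_rMatchings.1 (h𝒜 hM)).2) hint
          w1 w2 (hBeq ▸ hB)
        -- Here `n ≥ 3`, so φ(n, 2) is at least `Nat.choose 4 2 = 6`, above the triangle bound of 3.
        have h6 : (6 : ℕ) ≤ (2 * n - 2 * 1).choose 2 :=
          (by decide : 6 ≤ Nat.choose 4 2).trans (Nat.choose_le_choose 2 (by omega))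
        have hphi : matchingPhi n 2 = ((2 * n - 2 * 1).choose 2 : ℕ) := by
          simp [matchingPhi]
        rw [hphi] at heq
        have := Nat.cast_injective heq
        omega
      · exact hc.center_mem hcen h3 hN hint hp (mem_rMatchings.1 (h𝒜 hB)).1 hB
    refine ⟨c p, he, Finset.eq_of_subset_of_card_le
      (fun B hB => Finset.mem_filter.2 ⟨h𝒜 hB, hmem B hB⟩) ?_⟩
    have := card_matchingStar hr he
    rw [← heq] at this
    exact (Nat.cast_injective this).le
  · rintro ⟨e, he, rfl⟩
    exact card_matchingStar hr he
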